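/- Let $f_0:[0,1]\to\mathbb R$ be nondecreasing and continuous. Let $X_1,X_2,\dots$ be i.i.d. random variables with a continuous density $g$ on $[0,1]$ that is bounded away from zero there and whose derivative $g'$ exists, is continuous and is bounded on $(0,1)$. Let $\varepsilon_1,\varepsilon_2,\dots$ be i.i.d. sub-Gaussian random variables with mean zero and variance $\sigma_0^2\in(0,\infty)$, the sequence $(\varepsilon_i)$ being independent of the sequence $(X_i)$, and put $Y_i=f_0(X_i)+\varepsilon_i$. For each $n$ let $\hat f_n$ be a monotone least squares estimator based on $(X_1,Y_1),\dots,(X_n,Y_n)$, i.e. a nondecreasing function that minimizes $\sum_{i=1}^n\{Y_i-f(X_i)\}^2$ over all nondecreasing functions $f$ (any such minimizer, in particular the usual step function). Let $K\ge 0$ be a symmetric, twice continuously differentiable kernel on $\mathbb R$ that vanishes outside $[-1,1]$ and satisfies $\int K(u)\,du=1$ (for example the triweight kernel $K(u)=\tfrac{35}{32}(1-u^2)^3 1_{[-1,1]}(u)$), let $K_h(u)=h^{-1}K(u/h)$, and define the smoothed least squares estimator (SLSE) with bandwidth $h$ by $$\tilde f_{nh}(s)=\int_0^1 K_h(s-x)\,\hat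 f_n(x)\,dx .$$ Let $t\in(0,1)$ be such that $f_0$ is twice differentiable in a neighborhood of $t$, $f_0''$ is continuous at $t$, $f_0'(t)>0$ and $f_0''(t)\neq0$. Let $h_0=h_{n,0}$ be pilot bandwidths with $h_{n,0}\sim c_0 n^{-1/9}$ as $n\to\infty$, for some constant $c_0>0$. Then $\tilde f_{nh_0}$ is twice continuously differentiable and $$\tilde f_{nh_0}''(t)\ \stackrel{p}{\longrightarrow}\ f_0''(t),\qquad n\to\infty .$$ -/

import Mathlib

open MeasureTheory ProbabilityTheory Filter Topology

/-- `f` is a monotone least squares estimate for the data `(x 0, y 0), …, (x (n-1), y (n-1))`: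
it minimizes the sum of squared residuals over all nondecreasing functions. The values of `f` at
the design points are determined by this; between them `f` may be any monotone interpolation, in
particular the step function that is constant between design points. -/
structure IsMonotoneLSE (n : ℕ) (x y : ℕ → ℝ) (f : ℝ → ℝ) : Prop where
  monotone : Monotone f
  minimizes : ∀ φ : ℝ → ℝ, Monotone φ →
    ∑ i ∈ Finset.range n, (y i - f (x i)) ^ 2 ≤ ∑ i ∈ Finset.range n, (y i - φ (x i)) ^ 2

/-- A monotone least squares estimate exists for all data. -/
theorem exists_isMonotoneLSE (n : ℕ) (x y : ℕ → ℝ) : ∃ f, IsMonotoneLSE n x y f := by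
  let C : Set (EuclideanSpace ℝ (Fin n)) := {v | ∀ i j : Fin n, x i ≤ x j → v i ≤ v j}
  have hC : IsClosed C := by
    have : C = ⋂ (i : Fin n) (j : Fin n) (_ : x i ≤ x j), {v | v i ≤ v j} := by
      ext v; simp [C]
    rw [this]
    refine isClosed_iInter fun i => isClosed_iInter fun j => isClosed_iInter fun _ =>
      isClosed_le (by fun_prop) (by fun_prop)
  have hne : C.Nonempty := ⟨0, by intro i j _; simp⟩
  let w : EuclideanSpace ℝ (Fin n) := WithLp.toLp 2 fun i => y i
  obtain ⟨v, hv, hd⟩ := hC.exists_infDist_eq_dist hne w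
  obtain ⟨f, hf, hfv⟩ : ∃ f : ℝ → ℝ, Monotone f ∧ ∀ i : Fin n, f (x i) = v i := by
    let s : Set ℝ := Set.range fun i : Fin n => x i
    have hch : ∀ z : ℝ, ∃ r : ℝ, ∀ i : Fin n, x i = z → v i = r := by
      intro z
      by_cases hz : ∃ i : Fin n, x i = z
      · obtain ⟨i, hi⟩ := hz
        exact ⟨v i, fun j hj => le_antisymm (hv j i (by rw [hi, hj])) (hv i j (by rw [hi, hj]))⟩
      · exact ⟨0, fun i hi => (hz ⟨i, hi⟩).elim⟩
    choose F hF using hch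
    have hs : s.Finite := Set.finite_range _
    have hmono : MonotoneOn F s := by
      rintro _ ⟨i, rfl⟩ _ ⟨j, rfl⟩ hij
      rw [← hF _ i rfl, ← hF _ j rfl]
      exact hv i j hij
    obtain ⟨f, hf, hEq⟩ := hmono.exists_monotone_extension
      (hs.image F).bddBelow (hs.image F).bddAbove
    exact ⟨f, hf, fun i => by rw [← hEq ⟨i, rfl⟩, ← hF _ i rfl]⟩
  refine ⟨f, hf, fun φ hφ => ?_⟩
  have hmem : (WithLp.toLp 2 fun i : Fin n => φ (x i) : EuclideanSpace ℝ (Fin n)) ∈ C :=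
    fun i j hij => hφ hij
  have hle := Metric.infDist_le_dist_of_mem (x := w) hmem
  rw [hd, EuclideanSpace.dist_eq, EuclideanSpace.dist_eq] at hle
  have h2 := (Real.sqrt_le_sqrt_iff (by positivity)).1 hle
  simpa [w, Real.dist_eq, sq_abs, Finset.sum_range, hfv] using h2

/-- A symmetric, nonnegative, twice continuously differentiable kernel supported in `[-1, 1]`
with integral one. -/
structure IsSmoothingKernel (K : ℝ → ℝ) : Prop where
  contDiff : ContDiff ℝ 2 K
  symmetric : ∀ u, K (-u) = K u
  nonneg : ∀ u, 0 ≤ K u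
  support_subset : Function.support K ⊆ Set.Icc (-1) 1
  integral_eq_one : ∫ u, K u = 1

/-- The scaled kernel `K_h(u) = K(u / h) / h`. -/
noncomputable def scaledKernel (K : ℝ → ℝ) (h u : ℝ) : ℝ :=
  1 / h * K (u / h)

/-- The smoothed least squares estimate with bandwidth `h` built from `fhat` on `[0, 1]`:
the map `s ↦ ∫ K_h(s - x) fhat(x) dx`. For `s ∈ [h, 1 - h]` the kernel `K_h(s - ·)` is supported
in `[0, 1]`, so no boundary correction enters there. -/
noncomputable def slse (K : ℝ → ℝ) (h : ℝ) (fhat : ℝ → ℝ) (s : ℝ) : ℝ :=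
  ∫ x in (0 : ℝ)..1, scaledKernel K h (s - x) * fhat x

/-!
The proof bounds the error of the least squares estimate `f̂ₙ` uniformly near `t`, with an
elementary argument that replaces the entropy theory of monotone regression.

*Uniform rate.* Shifting `f̂ₙ` on a level block gives the one-sided inequality
`IsMonotoneLSE.card_mul_le_sum`: the value `f̂ₙ(z)` is at most the average of the responses over a
block of consecutive design points which contains all design points of `[z, u]`. By monotonicity
of `f₀`, this average is at most `f₀(u)` plus an average of errors over the block; reflection gives
the lower bound. Conditionally on the design there are at most `n²` blocks, so sub-Gaussian tails
and a union bound show that, with probability tending to one, every block `B` satisfies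
`|∑_B εᵢ| ≤ n^{1/36} √|B|` (`measureReal_not_noiseBound_le`). By Chebyshev's inequality, each of
`m ∼ n^{1/3}` cells of length `1/m` contains at least a constant times `n / m` design points
(`measureReal_not_cellBound_le`). With `u = z + 2/m` and `f₀` Lipschitz near `t`, this yields
`sup |f̂ₙ - f₀| = O(n^{-1/3 + 1/36})` on a neighbourhood of `t` (`IsMonotoneLSE.abs_sub_le`).

*Smoothing.* The second derivative of the smoothed estimate at `t` is `∫ k''(t - x) f̂ₙ(x) dx` for
the scaled kernel `k`, with `|k''| ≤ M h⁻³` on a window of length `2h`. Integrating by parts twice,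
the same integral with the second-order Taylor polynomial of `f₀` at `t` in place of `f̂ₙ` is exactly
`f₀''(t)`. Hence the error is at most `2M h⁻²` times the distance of `f̂ₙ` to that polynomial on the
window (`abs_iteratedDeriv_slse_sub_le`), which is `O(n^{-11/36}) + o(h²)`. Since `h²` is of the
order `n^{-8/36}`, the error tends to zero in probability.
-/

/-! ### First-order inequalities for the monotone least squares estimate -/

/-- Lowering the estimate slightly on the design points of `{c ≤ f} ∩ (-∞, u]` keeps it monotone,
so minimality forces the residuals over these points to have a nonnegative sum. -/
theorem IsMonotoneLSE.card_mul_le_sum {n : ℕ} {x y : ℕ → ℝ} {f : ℝ → ℝ}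
    (h : IsMonotoneLSE n x y f) (c u : ℝ) :
    (((Finset.range n).filter fun i => c ≤ f (x i) ∧ x i ≤ u).card : ℝ) * c ≤
      ∑ i ∈ (Finset.range n).filter (fun i => c ≤ f (x i) ∧ x i ≤ u), y i := by
  set B := (Finset.range n).filter (fun i => c ≤ f (x i) ∧ x i ≤ u) with hB
  have key : ∀ᶠ η in 𝓝[>] (0 : ℝ), 0 ≤ 2 * ∑ i ∈ B, (y i - f (x i)) + B.card * η := by
    have hgap : ∀ᶠ η in 𝓝[>] (0 : ℝ), ∀ i ∈ Finset.range n, f (x i) < c → f (x i) ≤ c - η := by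
      rw [Filter.eventually_all_finset]
      intro i _
      by_cases hi : f (x i) < c
      · have : ∀ᶠ η in 𝓝[>] (0 : ℝ), η < c - f (x i) :=
          (eventually_lt_nhds (by linarith)).filter_mono nhdsWithin_le_nhds
        filter_upwards [this] with η hη _
        linarith
      · exact Eventually.of_forall fun η h' => absurd h' hi
    filter_upwards [hgap, self_mem_nhdsWithin] with η hη (hpos : 0 < η)
    -- The competitor: `ψ` lowers the values in `[c, ∞)` by `η`, is constant on `[c - η, c]`, and
    -- fixes the values below `c - η`; no design value of `f` lies in `(c - η, c)`.
    let ψ : ℝ → ℝ := fun v => min v (max (c - η) (v - η))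
    have hψ : Monotone ψ := fun a b hab =>
      min_le_min hab (max_le_max le_rfl (by linarith))
    let φ : ℝ → ℝ := fun z => if z ≤ u then ψ (f z) else f z
    have hφ : Monotone φ := by
      intro a b hab
      have hf := h.monotone hab
      simp only [φ]
      split_ifs with h1 h2 h2
      · exact hψ hf
      · exact (min_le_left _ _).trans hf
      · exact absurd (hab.trans h2) h1
      · exact hf
    have hval : ∀ i ∈ Finset.range n, (y i - φ (x i)) ^ 2 = (y i - f (x i)) ^ 2 +
        if c ≤ f (x i) ∧ x i ≤ u then 2 * η * (y i - f (x i)) + η ^ 2 else 0 := by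
      intro i hi
      by_cases hu : x i ≤ u
      · by_cases hc : c ≤ f (x i)
        · have : φ (x i) = f (x i) - η := by
            simp only [φ, ψ, if_pos hu]
            rw [max_eq_right (by linarith), min_eq_right (by linarith)]
          rw [if_pos ⟨hc, hu⟩, this]; ring
        · have h1 := hη i hi (not_le.1 hc)
          have : φ (x i) = f (x i) := by
            simp only [φ, ψ, if_pos hu]
            exact min_eq_left (h1.trans (le_max_left _ _))
          rw [if_neg (fun h => hc h.1), this, add_zero]
      · have : φ (x i) = f (x i) := by simp only [φ, if_neg hu]
        rw [if_neg (fun h => hu h.2), this, add_zero]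
    have hmin := h.minimizes φ hφ
    rw [Finset.sum_congr rfl hval, Finset.sum_add_distrib, ← Finset.sum_filter, ← hB,
      Finset.sum_add_distrib, ← Finset.mul_sum, Finset.sum_const, nsmul_eq_mul] at hmin
    have : 0 ≤ η * (2 * ∑ i ∈ B, (y i - f (x i)) + B.card * η) := by nlinarith
    exact nonneg_of_mul_nonneg_right this hpos
  have hlim : Tendsto (fun η : ℝ => 2 * ∑ i ∈ B, (y i - f (x i)) + B.card * η) (𝓝[>] 0)
      (𝓝 (2 * ∑ i ∈ B, (y i - f (x i)) + B.card * 0)) :=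
    (Continuous.tendsto (by fun_prop) 0).mono_left nhdsWithin_le_nhds
  have h0 := ge_of_tendsto hlim key
  rw [Finset.sum_sub_distrib] at h0
  have hc : (B.card : ℝ) * c ≤ ∑ i ∈ B, f (x i) := by
    rw [← nsmul_eq_mul]
    exact Finset.card_nsmul_le_sum _ _ _ fun i hi => (Finset.mem_filter.1 hi).2.1
  linarith

theorem IsMonotoneLSE.reflect {n : ℕ} {x y : ℕ → ℝ} {f : ℝ → ℝ} (h : IsMonotoneLSE n x y f) :
    IsMonotoneLSE n (fun i => -x i) (fun i => -y i) (fun z => -f (-z)) where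
  monotone a b hab := neg_le_neg (h.monotone (neg_le_neg hab))
  minimizes φ hφ := by
    have := h.minimizes (fun z => -φ (-z)) fun a b hab => neg_le_neg (hφ (neg_le_neg hab))
    refine (Eq.le ?_).trans (this.trans (Eq.le ?_))
    · refine Finset.sum_congr rfl fun i _ => ?_
      simp only [neg_neg]; ring
    · refine Finset.sum_congr rfl fun i _ => ?_
      ring

/-- The indices of the design points between the `j`-th and the `k`-th one. -/
noncomputable def orderBlock (n : ℕ) (x : ℕ → ℝ) (j k : ℕ) : Finset ℕ :=
  (Finset.range n).filter fun i => x j ≤ x i ∧ x i ≤ x k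

/-- The sum of the errors over every block of consecutive design points is at most `lam` times the
square root of the length of the block. -/
def NoiseBound (n : ℕ) (x e : ℕ → ℝ) (lam : ℝ) : Prop :=
  ∀ j ∈ Finset.range n, ∀ k ∈ Finset.range n,
    |∑ i ∈ orderBlock n x j k, e i| ≤ lam * √((orderBlock n x j k).card : ℝ)

theorem NoiseBound.reflect {n : ℕ} {x e : ℕ → ℝ} {lam : ℝ} (h : NoiseBound n x e lam) :
    NoiseBound n (fun i => -x i) (fun i => -e i) lam := by
  intro j hj k hk
  have : orderBlock n (fun i => -x i) j k = orderBlock n x k j := by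
    ext i; simp [orderBlock, and_comm]
  rw [this, Finset.sum_neg_distrib, abs_neg]
  exact h k hk j hj

/-- An order-convex set of design points is a block between two of its members. -/
theorem exists_eq_orderBlock {n : ℕ} {x : ℕ → ℝ} {B : Finset ℕ} (hB : B ⊆ Finset.range n)
    (hne : B.Nonempty)
    (hconv : ∀ j ∈ B, ∀ k ∈ B, ∀ i ∈ Finset.range n, x j ≤ x i → x i ≤ x k → i ∈ B) :
    ∃ j ∈ Finset.range n, ∃ k ∈ Finset.range n, B = orderBlock n x j k := by
  obtain ⟨j, hj, hjm⟩ := B.exists_min_image x hne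
  obtain ⟨k, hk, hkm⟩ := B.exists_max_image x hne
  refine ⟨j, hB hj, k, hB hk, ?_⟩
  ext i
  simp only [orderBlock, Finset.mem_filter]
  exact ⟨fun hi => ⟨hB hi, hjm i hi, hkm i hi⟩, fun hi => hconv j hj k hk i hi.1 hi.2.1 hi.2.2⟩

/-- The design points of `{f z ≤ f} ∩ (-∞, u]` form a block on which the responses average to at
least `f z`. The block contains the design points of `[z, u]`, so its error average is small. -/
theorem IsMonotoneLSE.apply_le {n : ℕ} {x a e : ℕ → ℝ} {f : ℝ → ℝ}
    (h : IsMonotoneLSE n x (fun i => a i + e i) f) {lam : ℝ} (hlam : 0 ≤ lam)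
    (hnoise : NoiseBound n x e lam) {z u F N : ℝ} (hN : 0 < N)
    (hF : ∀ i ∈ Finset.range n, x i ≤ u → a i ≤ F)
    (hcard : N ≤ ((Finset.range n).filter fun i => z ≤ x i ∧ x i ≤ u).card) :
    f z ≤ F + lam / √N := by
  have hle := h.card_mul_le_sum (f z) u
  set B := (Finset.range n).filter (fun i => f z ≤ f (x i) ∧ x i ≤ u) with hB
  have hsub : ((Finset.range n).filter fun i => z ≤ x i ∧ x i ≤ u) ⊆ B := by
    intro i hi
    simp only [hB, Finset.mem_filter] at hi ⊢
    exact ⟨hi.1, h.monotone hi.2.1, hi.2.2⟩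
  have hNB : N ≤ B.card := hcard.trans (by exact_mod_cast Finset.card_le_card hsub)
  have hpos : (0 : ℝ) < B.card := hN.trans_le hNB
  have hne : B.Nonempty := Finset.card_pos.1 (by exact_mod_cast hpos)
  obtain ⟨j, hj, k, hk, hjk⟩ := exists_eq_orderBlock (x := x) (Finset.filter_subset _ _) hne
    (by
      intro j hj k hk i hi h1 h2
      simp only [Finset.mem_filter] at hj hk ⊢
      exact ⟨hi, hj.2.1.trans (h.monotone h1), h2.trans hk.2.2⟩)
  have hn := hnoise j hj k hk
  rw [← hjk] at hn
  have ha : ∑ i ∈ B, a i ≤ B.card * F := by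
    rw [← nsmul_eq_mul]
    refine Finset.sum_le_card_nsmul _ _ _ fun i hi => ?_
    have := Finset.mem_filter.1 hi
    exact hF i this.1 this.2.2
  rw [Finset.sum_add_distrib] at hle
  have h1 : (B.card : ℝ) * (f z - F) ≤ lam * √(B.card : ℝ) := by
    have := le_abs_self (∑ i ∈ B, e i); nlinarith
  have h2 : f z - F ≤ lam / √(B.card : ℝ) := by
    rw [le_div_iff₀ (Real.sqrt_pos.2 hpos)]
    have hs := Real.mul_self_sqrt hpos.le
    have hs0 := Real.sqrt_pos.2 hpos
    nlinarith
  have h3 : lam / √(B.card : ℝ) ≤ lam / √N := by gcongr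
  linarith

theorem IsMonotoneLSE.le_apply {n : ℕ} {x a e : ℕ → ℝ} {f : ℝ → ℝ}
    (h : IsMonotoneLSE n x (fun i => a i + e i) f) {lam : ℝ} (hlam : 0 ≤ lam)
    (hnoise : NoiseBound n x e lam) {z u F N : ℝ} (hN : 0 < N)
    (hF : ∀ i ∈ Finset.range n, u ≤ x i → F ≤ a i)
    (hcard : N ≤ ((Finset.range n).filter fun i => u ≤ x i ∧ x i ≤ z).card) :
    F - lam / √N ≤ f z := by
  have h' : IsMonotoneLSE n (fun i => -x i) (fun i => -a i + -e i) (fun z => -f (-z)) := by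
    have := h.reflect
    simpa only [neg_add] using this
  have := h'.apply_le hlam hnoise.reflect (z := -z) (u := -u) (F := -F) hN
    (fun i hi hu => neg_le_neg (hF i hi (neg_le_neg_iff.1 hu)))
    (by simpa only [neg_le_neg_iff, and_comm] using hcard)
  rw [neg_neg] at this
  linarith

/-! ### Uniform control of the errors -/

theorem ProbabilityTheory.HasSubgaussianMGF.of_le {Ω : Type*} [MeasurableSpace Ω] {μ : Measure Ω}
    {Z : Ω → ℝ} {c d : NNReal} (h : HasSubgaussianMGF Z c μ) (hcd : c ≤ d) :
    HasSubgaussianMGF Z d μ where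
  integrable_exp_mul := h.integrable_exp_mul
  mgf_le s := (h.mgf_le s).trans <| Real.exp_le_exp.2 <| by
    have : (c : ℝ) ≤ d := hcd
    gcongr

section Noise

variable {Ω : Type*} [MeasurableSpace Ω] {μ : Measure Ω} [IsProbabilityMeasure μ]

theorem measureReal_abs_sum_gt_le {e : ℕ → Ω → ℝ} (hindep : iIndepFun e μ) {v : NNReal}
    (hv : 0 < v) (hsub : ∀ i, HasSubgaussianMGF (e i) v μ) (S : Finset ℕ) {lam : ℝ}
    (hlam : 0 ≤ lam) :
    μ.real {ω | lam * √(S.card : ℝ) < |∑ i ∈ S, e i ω|} ≤ 2 * Real.exp (-lam ^ 2 / (2 * v)) := by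
  rcases S.eq_empty_or_nonempty with rfl | hS
  · simp; positivity
  have hcard : (0 : ℝ) < S.card := by exact_mod_cast Finset.card_pos.2 hS
  have hv' : (0 : ℝ) < v := hv
  have hexp : -(lam * √(S.card : ℝ)) ^ 2 / (2 * ((∑ _i ∈ S, v : NNReal) : ℝ)) =
      -lam ^ 2 / (2 * v) := by
    rw [Finset.sum_const, nsmul_eq_mul, mul_pow, Real.sq_sqrt hcard.le]
    push_cast
    field_simp
  have hneg : iIndepFun (fun i => -e i) μ := by
    have := hindep.comp (fun _ => Neg.neg) (fun _ => measurable_neg)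
    exact this
  have h1 := HasSubgaussianMGF.measure_sum_ge_le_of_iIndepFun hindep (c := fun _ => v) (s := S)
    (fun i _ => hsub i) (ε := lam * √(S.card : ℝ)) (by positivity)
  have h2 := HasSubgaussianMGF.measure_sum_ge_le_of_iIndepFun hneg (c := fun _ => v) (s := S)
    (fun i _ => (hsub i).neg) (ε := lam * √(S.card : ℝ)) (by positivity)
  rw [hexp] at h1 h2
  have hsubset : {ω | lam * √(S.card : ℝ) < |∑ i ∈ S, e i ω|} ⊆
      {ω | lam * √(S.card : ℝ) ≤ ∑ i ∈ S, e i ω} ∪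
        {ω | lam * √(S.card : ℝ) ≤ ∑ i ∈ S, (-e i) ω} := by
    intro ω hω
    simp only [Set.mem_ofPred_eq, Set.mem_union, Pi.neg_apply, Finset.sum_neg_distrib] at hω ⊢
    rcases lt_abs.1 hω with h | h
    · exact Or.inl h.le
    · exact Or.inr h.le
  calc _ ≤ _ := measureReal_mono hsubset (measure_ne_top _ _)
    _ ≤ _ := measureReal_union_le _ _
    _ ≤ _ := by linarith

theorem measurableSet_orderBlock_eq (n j k : ℕ) (S : Finset ℕ) :
    MeasurableSet {x : ℕ → ℝ | orderBlock n x j k = S} := by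
  have : {x : ℕ → ℝ | orderBlock n x j k = S} =
      ⋂ i, {x | (i ∈ Finset.range n ∧ x j ≤ x i ∧ x i ≤ x k) ↔ i ∈ S} := by
    ext x
    simp [orderBlock, Finset.ext_iff]
  rw [this]
  refine MeasurableSet.iInter fun i => ?_
  have hm : MeasurableSet {x : ℕ → ℝ | i ∈ Finset.range n ∧ x j ≤ x i ∧ x i ≤ x k} :=
    (MeasurableSet.const _).inter
      ((measurableSet_le (measurable_pi_apply j) (measurable_pi_apply i)).inter
        (measurableSet_le (measurable_pi_apply i) (measurable_pi_apply k)))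
  by_cases hi : i ∈ S
  · simpa only [hi, iff_true] using hm
  · simp only [hi, iff_false]
    exact hm.compl

/-- The block is a function of the design, which is independent of the errors. Splitting
according to its value therefore reduces the claim to sums over fixed index sets. -/
theorem measureReal_abs_sum_orderBlock_gt_le {X e : ℕ → Ω → ℝ} (hindep : iIndepFun e μ)
    (hX : ∀ i, Measurable (X i))
    (hXe : IndepFun (fun ω i => X i ω) (fun ω i => e i ω) μ) {v : NNReal}
    (hv : 0 < v) (hsub : ∀ i, HasSubgaussianMGF (e i) v μ) {lam : ℝ} (hlam : 0 ≤ lam)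
    (n j k : ℕ) :
    μ.real {ω | lam * √((orderBlock n (fun i => X i ω) j k).card : ℝ) <
      |∑ i ∈ orderBlock n (fun i => X i ω) j k, e i ω|} ≤ 2 * Real.exp (-lam ^ 2 / (2 * v)) := by
  set q := 2 * Real.exp (-lam ^ 2 / (2 * v))
  let P := (Finset.range n).powerset
  let A : Finset ℕ → Set Ω := fun S => (fun ω i => X i ω) ⁻¹' {x | orderBlock n x j k = S}
  let D : Finset ℕ → Set (ℕ → ℝ) := fun S => {y | lam * √(S.card : ℝ) < |∑ i ∈ S, y i|}
  have hXm : Measurable fun ω i => X i ω := measurable_pi_iff.2 hX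
  have hA : ∀ S, MeasurableSet (A S) := fun S => hXm (measurableSet_orderBlock_eq n j k S)
  have hD : ∀ S, MeasurableSet (D S) := fun S =>
    measurableSet_lt measurable_const (by fun_prop)
  have hsubset : {ω | lam * √((orderBlock n (fun i => X i ω) j k).card : ℝ) <
      |∑ i ∈ orderBlock n (fun i => X i ω) j k, e i ω|} ⊆
      ⋃ S ∈ P, (A S ∩ (fun ω i => e i ω) ⁻¹' (D S)) := by
    intro ω hω
    simp only [Set.mem_iUnion]
    exact ⟨orderBlock n (fun i => X i ω) j k, Finset.mem_powerset.2 (Finset.filter_subset _ _),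
      rfl, hω⟩
  have hterm : ∀ S ∈ P, μ.real (A S ∩ (fun ω i => e i ω) ⁻¹' (D S)) ≤ μ.real (A S) * q := by
    intro S _
    have := hXe.measure_inter_preimage_eq_mul _ _ (measurableSet_orderBlock_eq n j k S) (hD S)
    rw [measureReal_def, this, ENNReal.toReal_mul]
    exact mul_le_mul_of_nonneg_left (measureReal_abs_sum_gt_le hindep hv hsub S hlam)
      ENNReal.toReal_nonneg
  have hsum : ∑ S ∈ P, μ.real (A S) ≤ 1 := by
    rw [← measureReal_biUnion_finset _ (fun S _ => hA S)]
    · exact measureReal_le_one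
    · intro S _ T _ hST
      refine Set.disjoint_left.2 fun ω hS hT => hST ?_
      exact (hS : orderBlock n (fun i => X i ω) j k = S).symm.trans hT
  calc _ ≤ _ := measureReal_mono hsubset (measure_ne_top _ _)
    _ ≤ ∑ S ∈ P, μ.real (A S ∩ (fun ω i => e i ω) ⁻¹' (D S)) := measureReal_biUnion_finset_le _ _
    _ ≤ ∑ S ∈ P, μ.real (A S) * q := Finset.sum_le_sum hterm
    _ = (∑ S ∈ P, μ.real (A S)) * q := (Finset.sum_mul _ _ _).symm
    _ ≤ 1 * q := by gcongr
    _ = q := one_mul q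

theorem measureReal_not_noiseBound_le {X e : ℕ → Ω → ℝ} (hindep : iIndepFun e μ)
    (hX : ∀ i, Measurable (X i))
    (hXe : IndepFun (fun ω i => X i ω) (fun ω i => e i ω) μ) {v : NNReal}
    (hv : 0 < v) (hsub : ∀ i, HasSubgaussianMGF (e i) v μ) {lam : ℝ} (hlam : 0 ≤ lam) (n : ℕ) :
    μ.real {ω | ¬ NoiseBound n (fun i => X i ω) (fun i => e i ω) lam} ≤
      (n : ℝ) ^ 2 * (2 * Real.exp (-lam ^ 2 / (2 * v))) := by
  have hsubset : {ω | ¬ NoiseBound n (fun i => X i ω) (fun i => e i ω) lam} ⊆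
      ⋃ p ∈ Finset.range n ×ˢ Finset.range n,
        {ω | lam * √((orderBlock n (fun i => X i ω) p.1 p.2).card : ℝ) <
          |∑ i ∈ orderBlock n (fun i => X i ω) p.1 p.2, e i ω|} := by
    intro ω hω
    simp only [NoiseBound, Set.mem_ofPred_eq, not_forall, not_le] at hω
    obtain ⟨j, hj, k, hk, h⟩ := hω
    simp only [Set.mem_iUnion]
    exact ⟨(j, k), Finset.mk_mem_product hj hk, h⟩
  calc _ ≤ _ := measureReal_mono hsubset (measure_ne_top _ _)
    _ ≤ _ := measureReal_biUnion_finset_le _ _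
    _ ≤ ∑ _p ∈ Finset.range n ×ˢ Finset.range n, 2 * Real.exp (-lam ^ 2 / (2 * v)) :=
      Finset.sum_le_sum fun p _ =>
        measureReal_abs_sum_orderBlock_gt_le hindep hX hXe hv hsub hlam n p.1 p.2
    _ = _ := by
      rw [Finset.sum_const, Finset.card_product, Finset.card_range, nsmul_eq_mul]
      push_cast; ring

end Noise

/-! ### The number of design points in short intervals -/

/-- Each of the `m` cells `[k / m, (k + 1) / m]` of `[0, 1]` contains at least `N` of the first `n`
design points. -/
def CellBound (n m : ℕ) (N : ℝ) (x : ℕ → ℝ) : Prop :=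
  ∀ k ∈ Finset.range m, N ≤ ((Finset.range n).filter
    fun i => (k : ℝ) / m ≤ x i ∧ x i ≤ ((k : ℝ) + 1) / m).card

/-- An interval of length `2 / m` inside `[0, 1]` contains one of the cells. -/
theorem CellBound.le_card {n m : ℕ} {N : ℝ} {x : ℕ → ℝ} (h : CellBound n m N x) (hm : 0 < m)
    {a b : ℝ} (ha : 0 ≤ a) (hb : b ≤ 1) (hab : a + 2 / m ≤ b) :
    N ≤ ((Finset.range n).filter fun i => a ≤ x i ∧ x i ≤ b).card := by
  have hm' : (0 : ℝ) < m := by exact_mod_cast hm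
  have h1 : a * m ≤ ⌈a * m⌉₊ := Nat.le_ceil _
  have h2 : (⌈a * m⌉₊ : ℝ) < a * m + 1 := Nat.ceil_lt_add_one (by positivity)
  have h3 : a * m + 2 ≤ b * m := by
    have := mul_le_mul_of_nonneg_right hab hm'.le
    rwa [add_mul, div_mul_cancel₀ _ hm'.ne'] at this
  have hk : ⌈a * m⌉₊ < m := by
    have : (⌈a * m⌉₊ : ℝ) < m := by nlinarith
    exact_mod_cast this
  refine (h _ (Finset.mem_range.2 hk)).trans ?_
  refine Nat.cast_le.2 (Finset.card_le_card fun i hi => ?_)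
  simp only [Finset.mem_filter] at hi ⊢
  obtain ⟨hi0, hi1, hi2⟩ := hi
  rw [div_le_iff₀ hm'] at hi1
  rw [le_div_iff₀ hm'] at hi2
  exact ⟨hi0, le_of_mul_le_mul_right (h1.trans hi1) hm',
    le_of_mul_le_mul_right (by linarith) hm'⟩

section Counts

variable {Ω : Type*} [MeasurableSpace Ω] {μ : Measure Ω} [IsProbabilityMeasure μ]

/-- Chebyshev's inequality for the number of design points in an interval. -/
theorem measureReal_card_lt_le {X : ℕ → Ω → ℝ} (hX : ∀ i, Measurable (X i))
    (hindep : iIndepFun X μ) {a b p : ℝ} (hp : ∀ i, μ.real (X i ⁻¹' Set.Icc a b) = p)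
    (hp0 : 0 < p) {n : ℕ} (hn : 0 < n) :
    μ.real {ω | (((Finset.range n).filter fun i => a ≤ X i ω ∧ X i ω ≤ b).card : ℝ) < n * p / 2} ≤
      4 / (n * p) := by
  let Z : ℕ → Ω → ℝ := fun i => (Set.Icc a b).indicator (fun _ => 1) ∘ X i
  have hind : Measurable ((Set.Icc a b).indicator fun _ => (1 : ℝ)) :=
    measurable_const.indicator measurableSet_Icc
  have hZm : ∀ i, Measurable (Z i) := fun i => hind.comp (hX i)
  have hZb : ∀ i ω, ‖Z i ω‖ ≤ 1 := fun i ω => by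
    simp only [Z, Function.comp, Set.indicator_apply]; split_ifs <;> simp
  have hZL : ∀ i, MemLp (Z i) 2 μ := fun i =>
    MemLp.of_bound (hZm i).aestronglyMeasurable 1 (Eventually.of_forall (hZb i))
  have hZeq : ∀ i, Z i = (X i ⁻¹' Set.Icc a b).indicator fun _ => 1 := fun i => by
    ext ω; rfl
  have hZint : ∀ i, ∫ ω, Z i ω ∂μ = p := fun i => by
    rw [hZeq, integral_indicator_const _ (hX i measurableSet_Icc), hp]; simp
  have hZvar : ∀ i, Var[Z i; μ] ≤ p := fun i => by
    refine (variance_le_expectation_sq (hZm i).aestronglyMeasurable).trans (Eq.le ?_)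
    rw [← hZint i]
    congr 1; ext ω
    simp only [Z, Pi.pow_apply, Function.comp, Set.indicator_apply]; split_ifs <;> simp
  have hZind : iIndepFun Z μ := hindep.comp (fun _ => _) (fun _ => hind)
  have hvar : Var[∑ i ∈ Finset.range n, Z i; μ] ≤ n * p := by
    rw [IndepFun.variance_sum (fun i _ => hZL i) (fun i _ j _ hij => hZind.indepFun hij)]
    refine (Finset.sum_le_sum fun i _ => hZvar i).trans ?_
    simp
  have hmean : ∫ ω, (∑ i ∈ Finset.range n, Z i) ω ∂μ = n * p := by
    simp only [Finset.sum_apply]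
    rw [integral_finsetSum _ fun i _ => (hZL i).integrable (by norm_num)]
    simp [hZint]
  have hn' : (0 : ℝ) < n := by exact_mod_cast hn
  have hnp : 0 < n * p := by positivity
  have hcheb := meas_ge_le_variance_div_sq (memLp_finsetSum' (Finset.range n) fun i _ => hZL i)
    (half_pos hnp)
  rw [hmean] at hcheb
  have hcard : ∀ ω, (((Finset.range n).filter fun i => a ≤ X i ω ∧ X i ω ≤ b).card : ℝ) =
      (∑ i ∈ Finset.range n, Z i) ω := fun ω => by
    simp [Z, Set.indicator_apply, Finset.sum_apply, Set.mem_Icc]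
  have hsubset :
      {ω | (((Finset.range n).filter fun i => a ≤ X i ω ∧ X i ω ≤ b).card : ℝ) < n * p / 2} ⊆
      {ω | n * p / 2 ≤ |(∑ i ∈ Finset.range n, Z i) ω - n * p|} := by
    intro ω hω
    simp only [Set.mem_ofPred_eq, hcard] at hω ⊢
    rw [abs_sub_comm]
    exact le_trans (by linarith) (le_abs_self _)
  refine (measureReal_mono hsubset (measure_ne_top _ _)).trans ?_
  refine (ENNReal.toReal_le_of_le_ofReal
    (div_nonneg (variance_nonneg _ _) (by positivity)) hcheb).trans ?_
  rw [div_le_div_iff₀ (by positivity) hnp]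
  nlinarith

theorem measureReal_not_cellBound_le {X : ℕ → Ω → ℝ} (hX : ∀ i, Measurable (X i))
    (hindep : iIndepFun X μ) {g : ℝ → ℝ} {δ : ℝ} (hδ : 0 < δ)
    (hg : ∀ x ∈ Set.Icc (0 : ℝ) 1, δ ≤ g x)
    (hlaw : ∀ i, μ.map (X i) =
      (volume.restrict (Set.Icc 0 1)).withDensity (fun x => ENNReal.ofReal (g x)))
    {n m : ℕ} (hn : 0 < n) (hm : 0 < m) :
    μ.real {ω | ¬ CellBound n m (n * δ / (2 * m)) (fun i => X i ω)} ≤ 4 * m ^ 2 / (n * δ) := by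
  have hn' : (0 : ℝ) < n := by exact_mod_cast hn
  have hm' : (0 : ℝ) < m := by exact_mod_cast hm
  have hprob : ∀ k ∈ Finset.range m, ∃ p, δ / m ≤ p ∧
      ∀ i, μ.real (X i ⁻¹' Set.Icc ((k : ℝ) / m) (((k : ℝ) + 1) / m)) = p := by
    intro k hk
    have hk' : (k : ℝ) + 1 ≤ m := by exact_mod_cast Finset.mem_range.1 hk
    set I := Set.Icc ((k : ℝ) / m) (((k : ℝ) + 1) / m) with hI
    have hI01 : I ⊆ Set.Icc 0 1 := Set.Icc_subset_Icc (by positivity) ((div_le_one hm').2 hk')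
    have heq : ∀ i, μ.real (X i ⁻¹' I) = (μ.map (X i)).real I := fun i =>
      (map_measureReal_apply (hX i) measurableSet_Icc).symm
    refine ⟨(μ.map (X 0)).real I, ?_, fun i => by rw [heq, hlaw i, hlaw 0]⟩
    have hfin : IsProbabilityMeasure (μ.map (X 0)) :=
      Measure.isProbabilityMeasure_map (hX 0).aemeasurable
    have hle : ENNReal.ofReal δ * ENNReal.ofReal (1 / m) ≤ μ.map (X 0) I := by
      rw [hlaw 0, withDensity_apply _ measurableSet_Icc,
        Measure.restrict_restrict measurableSet_Icc, Set.inter_eq_left.2 hI01]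
      have hvol : volume I = ENNReal.ofReal (1 / m) := by
        rw [hI, Real.volume_Icc]; congr 1; ring
      rw [← hvol, ← setLIntegral_const]
      exact setLIntegral_mono' measurableSet_Icc fun x hx =>
        ENNReal.ofReal_le_ofReal (hg x (hI01 hx))
    rw [← ENNReal.ofReal_mul hδ.le] at hle
    have := (ENNReal.ofReal_le_iff_le_toReal (measure_ne_top _ _)).1 hle
    rwa [mul_one_div] at this
  have hcell : ∀ k ∈ Finset.range m, μ.real {ω | (((Finset.range n).filter
      fun i => (k : ℝ) / m ≤ X i ω ∧ X i ω ≤ ((k : ℝ) + 1) / m).card : ℝ) < n * δ / (2 * m)} ≤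
      4 * m / (n * δ) := by
    intro k hk
    obtain ⟨p, hp, hpX⟩ := hprob k hk
    have hδm : 0 < δ / m := by positivity
    have hnp : n * δ / m ≤ n * p := by
      rw [mul_div_assoc]; gcongr
    refine le_trans (measureReal_mono (fun ω hω => ?_) (measure_ne_top _ _))
      ((measureReal_card_lt_le hX hindep hpX (hδm.trans_le hp) hn).trans ?_)
    · refine lt_of_lt_of_le (b := n * δ / (2 * m)) hω ?_
      have : n * δ / (2 * m) = n * δ / m / 2 := by field_simp
      linarith
    · calc 4 / (n * p) ≤ 4 / (n * δ / m) := by gcongr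
        _ = 4 * m / (n * δ) := by field_simp
  have hsubset : {ω | ¬ CellBound n m (n * δ / (2 * m)) (fun i => X i ω)} ⊆
      ⋃ k ∈ Finset.range m, {ω | (((Finset.range n).filter
        fun i => (k : ℝ) / m ≤ X i ω ∧ X i ω ≤ ((k : ℝ) + 1) / m).card : ℝ) <
          n * δ / (2 * m)} := by
    intro ω hω
    simp only [CellBound, Set.mem_ofPred_eq, not_forall, not_le] at hω
    obtain ⟨k, hk, h⟩ := hω
    simp only [Set.mem_iUnion]
    exact ⟨k, hk, h⟩
  calc _ ≤ _ := measureReal_mono hsubset (measure_ne_top _ _)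
    _ ≤ _ := measureReal_biUnion_finset_le _ _
    _ ≤ ∑ _k ∈ Finset.range m, 4 * (m : ℝ) / (n * δ) := Finset.sum_le_sum hcell
    _ = _ := by
      rw [Finset.sum_const, Finset.card_range, nsmul_eq_mul]; ring

end Counts

/-- The design lies in `[0, 1]` almost surely. -/
theorem ae_forall_mem_Icc {Ω : Type*} [MeasurableSpace Ω] {μ : Measure Ω} {X : ℕ → Ω → ℝ}
    (hX : ∀ i, Measurable (X i)) {g : ℝ → ℝ}
    (hlaw : ∀ i, μ.map (X i) =
      (volume.restrict (Set.Icc 0 1)).withDensity (fun x => ENNReal.ofReal (g x))) :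
    ∀ᵐ ω ∂μ, ∀ i, X i ω ∈ Set.Icc (0 : ℝ) 1 := by
  rw [ae_all_iff]
  intro i
  refine ae_of_ae_map (hX i).aemeasurable (p := fun x => x ∈ Set.Icc (0 : ℝ) 1) ?_
  rw [hlaw i]
  exact (withDensity_absolutelyContinuous _ _).ae_le (ae_restrict_mem measurableSet_Icc)

/-! ### The second derivative of the smoothed estimate -/

section Smoothing

variable {K : ℝ → ℝ}

theorem IsSmoothingKernel.contDiff_scaledKernel (hK : IsSmoothingKernel K) (h : ℝ) :
    ContDiff ℝ 2 (scaledKernel K h) :=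
  contDiff_const.mul (hK.contDiff.comp (contDiff_id.div_const h))

/-- For `h = 0` the scaled kernel is zero, so that the bound holds for every `h`. -/
theorem IsSmoothingKernel.support_scaledKernel (hK : IsSmoothingKernel K) (h : ℝ) :
    Function.support (scaledKernel K h) ⊆ Set.Icc (-|h|) |h| := by
  intro u hu
  have hu' : 1 / h * K (u / h) ≠ 0 := hu
  have hh : h ≠ 0 := by rintro rfl; simp at hu'
  have h1 : u / h ∈ Set.Icc (-1 : ℝ) 1 := hK.support_subset (right_ne_zero_of_mul hu')
  have h2 : |u / h| ≤ 1 := abs_le.2 h1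
  rw [abs_div, div_le_one (abs_pos.2 hh)] at h2
  exact abs_le.1 h2

theorem IsSmoothingKernel.hasCompactSupport_scaledKernel (hK : IsSmoothingKernel K) (h : ℝ) :
    HasCompactSupport (scaledKernel K h) :=
  HasCompactSupport.of_support_subset_isCompact isCompact_Icc (hK.support_scaledKernel h)

/-- The smoothed estimate is the convolution of the estimate, cut off outside `[0, 1]`, with the
scaled kernel. -/
theorem slse_eq_convolution (K : ℝ → ℝ) (h : ℝ) (f : ℝ → ℝ) :
    slse K h f = convolution ((Set.Ioc 0 1).indicator f) (scaledKernel K h)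
      (ContinuousLinearMap.mul ℝ ℝ) volume := by
  ext s
  rw [slse, intervalIntegral.integral_of_le zero_le_one, convolution,
    ← integral_indicator measurableSet_Ioc]
  refine integral_congr_ae (Eventually.of_forall fun x => ?_)
  simp only [ContinuousLinearMap.mul_apply', Set.indicator_apply]
  split_ifs <;> ring

theorem Monotone.locallyIntegrable_indicator_Ioc {f : ℝ → ℝ} (hf : Monotone f) :
    LocallyIntegrable ((Set.Ioc (0 : ℝ) 1).indicator f) volume :=
  hf.locallyIntegrable.indicator measurableSet_Ioc

theorem contDiff_slse (hK : IsSmoothingKernel K) (h : ℝ) {f : ℝ → ℝ} (hf : Monotone f) :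
    ContDiff ℝ 2 (slse K h f) := by
  rw [slse_eq_convolution]
  exact (hK.hasCompactSupport_scaledKernel h).contDiff_convolution_right
    (ContinuousLinearMap.mul ℝ ℝ) (n := 2) hf.locallyIntegrable_indicator_Ioc
    (hK.contDiff_scaledKernel h)

theorem contDiff_one_deriv {k : ℝ → ℝ} (hk : ContDiff ℝ 2 k) : ContDiff ℝ 1 (deriv k) :=
  ((contDiff_succ_iff_deriv (n := 1)).1 hk).2.2

theorem iteratedDeriv_two_slse (hK : IsSmoothingKernel K) (h : ℝ) {f : ℝ → ℝ} (hf : Monotone f)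
    (s : ℝ) :
    iteratedDeriv 2 (slse K h f) s =
      ∫ x in (0 : ℝ)..1, deriv (deriv (scaledKernel K h)) (s - x) * f x := by
  have hcs := hK.hasCompactSupport_scaledKernel h
  have hk := hK.contDiff_scaledKernel h
  have hloc := hf.locallyIntegrable_indicator_Ioc
  have h1 : deriv (slse K h f) = convolution ((Set.Ioc 0 1).indicator f)
      (deriv (scaledKernel K h)) (ContinuousLinearMap.mul ℝ ℝ) volume := by
    ext x
    rw [slse_eq_convolution]
    exact (hcs.hasDerivAt_convolution_right _ hloc (hk.of_le (by norm_num)) x).deriv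
  rw [iteratedDeriv_succ, iteratedDeriv_one, h1,
    (hcs.deriv.hasDerivAt_convolution_right _ hloc (contDiff_one_deriv hk) s).deriv, convolution,
    intervalIntegral.integral_of_le zero_le_one, ← integral_indicator measurableSet_Ioc]
  refine integral_congr_ae (Eventually.of_forall fun x => ?_)
  simp only [ContinuousLinearMap.mul_apply', Set.indicator_apply]
  split_ifs <;> ring

theorem deriv_deriv_scaledKernel (hK : IsSmoothingKernel K) (h u : ℝ) :
    deriv (deriv (scaledKernel K h)) u = 1 / h ^ 3 * deriv (deriv K) (u / h) := by
  have hd : ∀ {F : ℝ → ℝ}, Differentiable ℝ F → ∀ (c x : ℝ),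
      HasDerivAt (fun y => c * F (y / h)) (c * (deriv F (x / h) * (1 / h))) x := by
    intro F hF c x
    have h1 : HasDerivAt (fun y : ℝ => y / h) (1 / h) x := (hasDerivAt_id x).div_const h
    exact ((hF (x / h)).hasDerivAt.comp x h1).const_mul c
  have h1 : deriv (scaledKernel K h) = fun y => 1 / h ^ 2 * deriv K (y / h) := by
    ext x
    have := (hd (hK.contDiff.differentiable (by norm_num)) (1 / h) x).deriv
    rw [show scaledKernel K h = fun y => 1 / h * K (y / h) from rfl, this]
    ring
  rw [h1, (hd ((contDiff_one_deriv hK.contDiff).differentiable (by norm_num)) _ u).deriv]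
  ring

theorem integral_scaledKernel (hK : IsSmoothingKernel K) {h : ℝ} (hh : 0 < h) :
    ∫ u, scaledKernel K h u = 1 := by
  simp only [scaledKernel]
  rw [integral_const_mul, Measure.integral_comp_div K h, hK.integral_eq_one, abs_of_pos hh]
  simp [hh.ne']

/-- Integrating by parts twice: the second derivative of the scaled kernel reproduces the second
derivative of a quadratic polynomial exactly. -/
theorem integral_deriv_deriv_scaledKernel_mul_quadratic (hK : IsSmoothingKernel K) {h t : ℝ}
    (hh : 0 < h) (h0 : 0 < t - h) (h1 : t + h < 1) (a b c : ℝ) :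
    ∫ x in (0 : ℝ)..1, deriv (deriv (scaledKernel K h)) (t - x) *
      (a + b * (x - t) + c / 2 * (x - t) ^ 2) = c := by
  set k := scaledKernel K h with hkdef
  have hk : ContDiff ℝ 2 k := hK.contDiff_scaledKernel h
  have hk1 := contDiff_one_deriv hk
  have hsupp : Function.support k ⊆ Set.Icc (-h) h := by
    have := hK.support_scaledKernel h; rwa [abs_of_pos hh] at this
  have hdsupp : Function.support (deriv k) ⊆ Set.Icc (-h) h :=
    (support_deriv_subset).trans (closure_minimal hsupp isClosed_Icc)
  have hz : ∀ u, u ∉ Set.Icc (-h) h → k u = 0 ∧ deriv k u = 0 := fun u hu =>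
    ⟨by_contra fun hne => hu (hsupp hne), by_contra fun hne => hu (hdsupp hne)⟩
  have hz0 := hz (t - 0) (fun hm => by have := hm.2; linarith)
  have hz1 := hz (t - 1) (fun hm => by have := hm.1; linarith)
  have hcont : Continuous (deriv (deriv k)) :=
    hk1.continuous_deriv (by norm_num)
  -- `-k'(t - x) q(x) - k(t - x) q'(x)` is an antiderivative of `k''(t - x) q(x) - k(t - x) q''`.
  have hder : ∀ x ∈ Set.uIcc (0 : ℝ) 1, HasDerivAt
      (fun x => -(deriv k (t - x) * (a + b * (x - t) + c / 2 * (x - t) ^ 2)) -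
        k (t - x) * (b + c * (x - t)))
      (deriv (deriv k) (t - x) * (a + b * (x - t) + c / 2 * (x - t) ^ 2) - k (t - x) * c) x := by
    intro x _
    have hs : HasDerivAt (fun x : ℝ => t - x) (-1) x := (hasDerivAt_id x).const_sub t
    have hx : HasDerivAt (fun x : ℝ => x - t) 1 x := (hasDerivAt_id x).sub_const t
    have e1 : HasDerivAt (fun x => k (t - x)) (deriv k (t - x) * -1) x :=
      ((hk.differentiable (by norm_num) (t - x)).hasDerivAt).comp x hs
    have e2 : HasDerivAt (fun x => deriv k (t - x)) (deriv (deriv k) (t - x) * -1) x :=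
      ((hk1.differentiable (by norm_num) (t - x)).hasDerivAt).comp x hs
    have e3 : HasDerivAt (fun x : ℝ => a + b * (x - t) + c / 2 * (x - t) ^ 2)
        (b * 1 + c / 2 * (2 * (x - t) ^ 1 * 1)) x := by
      exact ((hx.const_mul b).const_add a).add ((hx.pow 2).const_mul (c / 2))
    have e4 : HasDerivAt (fun x : ℝ => b + c * (x - t)) (c * 1) x :=
      (hx.const_mul c).const_add b
    refine HasDerivAt.congr_deriv ((e2.mul e3).neg.sub (e1.mul e4)) ?_
    ring
  have hc1 : Continuous fun x => deriv (deriv k) (t - x) *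
      (a + b * (x - t) + c / 2 * (x - t) ^ 2) := by fun_prop
  have hc2 : Continuous fun x => k (t - x) * c := by
    have := hk.continuous; fun_prop
  have hftc := intervalIntegral.integral_eq_sub_of_hasDerivAt hder
    ((hc1.sub hc2).intervalIntegrable 0 1)
  rw [intervalIntegral.integral_sub (hc1.intervalIntegrable 0 1) (hc2.intervalIntegrable 0 1),
    hz0.1, hz0.2, hz1.1, hz1.2, intervalIntegral.integral_mul_const] at hftc
  have hone : ∫ x in (0 : ℝ)..1, k (t - x) = 1 := by
    rw [intervalIntegral.integral_eq_integral_of_support_subset,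
      integral_sub_left_eq_self k volume t, integral_scaledKernel hK hh]
    intro x hx
    have := hsupp (show k (t - x) ≠ 0 from hx)
    exact ⟨by linarith [this.2], by linarith [this.1]⟩
  rw [hone] at hftc
  linarith

theorem IsSmoothingKernel.exists_bound (hK : IsSmoothingKernel K) :
    ∃ M, 0 < M ∧ ∀ u, |deriv (deriv K) u| ≤ M := by
  have hcs : HasCompactSupport K :=
    HasCompactSupport.of_support_subset_isCompact isCompact_Icc hK.support_subset
  obtain ⟨C, hC⟩ := hcs.deriv.deriv.exists_bound_of_continuous
    ((contDiff_one_deriv hK.contDiff).continuous_deriv (by norm_num))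
  exact ⟨max C 1, by positivity, fun u => (hC u).trans (le_max_left _ _)⟩

/-- If `f` is uniformly close to a quadratic polynomial on the window `[t - h, t + h]`, then the
second derivative of the smoothed function at `t` is close to that of the polynomial. -/
theorem abs_iteratedDeriv_slse_sub_le (hK : IsSmoothingKernel K) {M : ℝ}
    (hM : ∀ u, |deriv (deriv K) u| ≤ M) {h t : ℝ}
    (hh : 0 < h) (h0 : 0 < t - h) (h1 : t + h < 1) {f : ℝ → ℝ} (hf : Monotone f) {a b c E : ℝ}
    (hE : ∀ x ∈ Set.Icc (t - h) (t + h), |f x - (a + b * (x - t) + c / 2 * (x - t) ^ 2)| ≤ E) :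
    |iteratedDeriv 2 (slse K h f) t - c| ≤ 2 * M * E / h ^ 2 := by
  set k := scaledKernel K h with hkdef
  have hk : ContDiff ℝ 2 k := hK.contDiff_scaledKernel h
  have hcont : Continuous (deriv (deriv k)) :=
    (contDiff_one_deriv hk).continuous_deriv (by norm_num)
  have hsupp : Function.support (deriv (deriv k)) ⊆ Set.Icc (-h) h := by
    have := hK.support_scaledKernel h
    rw [abs_of_pos hh] at this
    exact support_deriv_subset.trans (closure_minimal (support_deriv_subset.trans
      (closure_minimal this isClosed_Icc)) isClosed_Icc)
  have hcc : Continuous fun x => deriv (deriv k) (t - x) := by fun_prop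
  have hint1 : IntervalIntegrable (fun x => deriv (deriv k) (t - x) * f x) volume 0 1 :=
    hf.intervalIntegrable.continuousOn_mul hcc.continuousOn
  have hint2 : IntervalIntegrable (fun x => deriv (deriv k) (t - x) *
      (a + b * (x - t) + c / 2 * (x - t) ^ 2)) volume 0 1 :=
    Continuous.intervalIntegrable (by fun_prop) 0 1
  have hzero : ∀ x, x ∉ Set.Icc (t - h) (t + h) → deriv (deriv k) (t - x) = 0 := fun x hx =>
    by_contra fun hne => hx <| by
      have := hsupp hne
      exact ⟨by linarith [this.2], by linarith [this.1]⟩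
  rw [iteratedDeriv_two_slse hK h hf, ← hkdef]
  rw [← integral_deriv_deriv_scaledKernel_mul_quadratic hK hh h0 h1 a b c]
  rw [← intervalIntegral.integral_sub hint1 hint2]
  have hwin : ∫ x in (0 : ℝ)..1, (deriv (deriv k) (t - x) * f x -
        deriv (deriv k) (t - x) * (a + b * (x - t) + c / 2 * (x - t) ^ 2)) =
      ∫ x in (t - h)..(t + h), (deriv (deriv k) (t - x) * f x -
        deriv (deriv k) (t - x) * (a + b * (x - t) + c / 2 * (x - t) ^ 2)) := by
    rw [intervalIntegral.integral_of_le zero_le_one,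
      intervalIntegral.integral_of_le (by linarith), ← integral_Icc_eq_integral_Ioc,
      ← integral_Icc_eq_integral_Ioc]
    refine (setIntegral_eq_of_subset_of_forall_sdiff_eq_zero measurableSet_Icc
      (Set.Icc_subset_Icc h0.le h1.le) fun x hx => ?_)
    rw [hzero x hx.2]; ring
  rw [hwin]
  have hbound := intervalIntegral.norm_integral_le_of_norm_le_const (a := t - h) (b := t + h)
    (C := M / h ^ 3 * E) (f := fun x => deriv (deriv k) (t - x) * f x -
        deriv (deriv k) (t - x) * (a + b * (x - t) + c / 2 * (x - t) ^ 2)) (by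
    intro x hx
    rw [Set.uIoc_of_le (by linarith)] at hx
    rw [← mul_sub, norm_mul, Real.norm_eq_abs, Real.norm_eq_abs, hkdef,
      deriv_deriv_scaledKernel hK, abs_mul, abs_of_pos (by positivity : 0 < 1 / h ^ 3)]
    have e1 := hM ((t - x) / h)
    have e2 := hE x ⟨hx.1.le, hx.2⟩
    have e3 : 0 ≤ M := (abs_nonneg _).trans e1
    calc 1 / h ^ 3 * |deriv (deriv K) ((t - x) / h)| * _ ≤ 1 / h ^ 3 * M * E := by gcongr
      _ = M / h ^ 3 * E := by ring)
  rw [Real.norm_eq_abs] at hbound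
  refine hbound.trans (Eq.le ?_)
  rw [show t + h - (t - h) = 2 * h by ring, abs_of_pos (by linarith)]
  field_simp

end Smoothing

/-! ### Local behaviour of the regression function -/

theorem exists_lipschitz_near {f : ℝ → ℝ} {t : ℝ} (hd : ∀ᶠ x in 𝓝 t, DifferentiableAt ℝ f x)
    (hc : ContinuousAt (deriv f) t) :
    ∃ L, 0 ≤ L ∧ ∃ r > 0, ∀ x ∈ Set.Icc (t - r) (t + r), ∀ y ∈ Set.Icc (t - r) (t + r),
      |f y - f x| ≤ L * |y - x| := by
  have hb : ∀ᶠ x in 𝓝 t, ‖deriv f x‖ < ‖deriv f t‖ + 1 :=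
    hc.norm.eventually_lt_const (lt_add_one _)
  obtain ⟨r, hr, hball⟩ := Metric.nhds_basis_closedBall.mem_iff.1 (hd.and hb)
  rw [Real.closedBall_eq_Icc] at hball
  exact ⟨‖deriv f t‖ + 1, by positivity, r, hr, fun x hx y hy =>
    Convex.norm_image_sub_le_of_norm_deriv_le (fun z hz => (hball hz).1)
      (fun z hz => (hball hz).2.le) (convex_Icc _ _) hx hy⟩

/-- Taylor's formula of order two with Peano remainder. -/
theorem exists_abs_sub_taylor_le {f : ℝ → ℝ} {t : ℝ} (hd : ∀ᶠ x in 𝓝 t, DifferentiableAt ℝ f x)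
    (hd2 : DifferentiableAt ℝ (deriv f) t) {η : ℝ} (hη : 0 < η) :
    ∃ r > 0, ∀ x, |x - t| ≤ r →
      |f x - (f t + deriv f t * (x - t) + iteratedDeriv 2 f t / 2 * (x - t) ^ 2)| ≤
        η * (x - t) ^ 2 := by
  have hc : iteratedDeriv 2 f t = deriv (deriv f) t := by
    rw [iteratedDeriv_succ, iteratedDeriv_one]
  rw [hc]
  set c := deriv (deriv f) t
  have hlo := (hasDerivAt_iff_isLittleO.1 hd2.hasDerivAt).bound hη
  obtain ⟨r, hr, hball⟩ := Metric.nhds_basis_closedBall.mem_iff.1 (hd.and hlo)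
  refine ⟨r, hr, fun x hx => ?_⟩
  let D : ℝ → ℝ := fun z => f z - (f t + deriv f t * (z - t) + c / 2 * (z - t) ^ 2)
  have hsub : Metric.closedBall t |x - t| ⊆ Metric.closedBall t r :=
    Metric.closedBall_subset_closedBall hx
  have hder : ∀ z ∈ Metric.closedBall t |x - t|, HasDerivWithinAt D
      (deriv f z - deriv f t - (z - t) * c) (Metric.closedBall t |x - t|) z := by
    intro z hz
    have h1 : HasDerivAt (fun z : ℝ => z - t) 1 z := (hasDerivAt_id z).sub_const t
    have h2 : HasDerivAt (fun z : ℝ => f t + deriv f t * (z - t) + c / 2 * (z - t) ^ 2)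
        (deriv f t * 1 + c / 2 * (2 * (z - t) ^ 1 * 1)) z :=
      ((h1.const_mul _).const_add _).add ((h1.pow 2).const_mul _)
    refine (((hball (hsub hz)).1.hasDerivAt.sub h2).congr_deriv ?_).hasDerivWithinAt
    ring
  have hbd : ∀ z ∈ Metric.closedBall t |x - t|,
      ‖deriv f z - deriv f t - (z - t) * c‖ ≤ η * |x - t| := by
    intro z hz
    refine (hball (hsub hz)).2.trans ?_
    rw [Metric.mem_closedBall, Real.dist_eq] at hz
    exact mul_le_mul_of_nonneg_left hz hη.le
  have := Convex.norm_image_sub_le_of_norm_hasDerivWithin_le hder hbd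
    (convex_closedBall t |x - t|) (Metric.mem_closedBall_self (abs_nonneg _))
    (show x ∈ Metric.closedBall t |x - t| from le_of_eq (Real.dist_eq x t))
  have hDt : D t = 0 := by simp [D]
  rw [hDt, sub_zero, Real.norm_eq_abs, Real.norm_eq_abs, mul_assoc, abs_mul_abs_self,
    ← sq] at this
  exact this

/-! ### The rate of the least squares estimate near an interior point -/

/-- Comparing the estimate at `z` with the regression function at distance `2 / m` costs `2 L / m`
in bias, and averages the errors over at least `N` design points. -/
theorem IsMonotoneLSE.abs_sub_le {n m : ℕ} {x e : ℕ → ℝ} {f f₀ : ℝ → ℝ}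
    (h : IsMonotoneLSE n x (fun i => f₀ (x i) + e i) f)
    (hf₀ : MonotoneOn f₀ (Set.Icc 0 1)) (hx : ∀ i, x i ∈ Set.Icc (0 : ℝ) 1)
    {lam N : ℝ} (hlam : 0 ≤ lam) (hnoise : NoiseBound n x e lam) (hN : 0 < N)
    (hcell : CellBound n m N x) (hm : 0 < m) {L t r : ℝ} (hr0 : 0 ≤ t - r) (hr1 : t + r ≤ 1)
    (hL : ∀ x ∈ Set.Icc (t - r) (t + r), ∀ y ∈ Set.Icc (t - r) (t + r),
      |f₀ y - f₀ x| ≤ L * |y - x|)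
    {w : ℝ} (hw : w + 2 / m ≤ r) {z : ℝ} (hz : z ∈ Set.Icc (t - w) (t + w)) :
    |f z - f₀ z| ≤ L * (2 / m) + lam / √N := by
  obtain ⟨hz0, hz1⟩ := hz
  have hm' : (0 : ℝ) < 2 / m := by positivity
  have hzm : z ∈ Set.Icc (t - r) (t + r) := ⟨by linarith, by linarith⟩
  have hzp : z + 2 / m ∈ Set.Icc (t - r) (t + r) := ⟨by linarith, by linarith⟩
  have hzn : z - 2 / m ∈ Set.Icc (t - r) (t + r) := ⟨by linarith, by linarith⟩
  have hup := h.apply_le hlam hnoise (z := z) (u := z + 2 / m) (F := f₀ (z + 2 / m)) hN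
    (fun i _ hi => hf₀ (hx i) ⟨by linarith [hzp.1], by linarith [hzp.2]⟩ hi)
    (hcell.le_card hm (by linarith [hzm.1]) (by linarith [hzp.2]) le_rfl)
  have hlow := h.le_apply hlam hnoise (z := z) (u := z - 2 / m) (F := f₀ (z - 2 / m)) hN
    (fun i _ hi => hf₀ ⟨by linarith [hzn.1], by linarith [hzn.2]⟩ (hx i) hi)
    (hcell.le_card hm (by linarith [hzn.1]) (by linarith [hzm.2]) (by linarith))
  have h1 := hL z hzm _ hzp
  have h2 := hL z hzm _ hzn
  rw [add_sub_cancel_left, abs_of_pos hm'] at h1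
  rw [show z - 2 / m - z = -(2 / (m : ℝ)) by ring, abs_neg, abs_of_pos hm'] at h2
  rw [abs_le] at h1 h2 ⊢
  exact ⟨by linarith [h2.1], by linarith [h1.2]⟩

/-! ### Asymptotics of the tuning sequences -/

theorem tendsto_sq_mul_exp_neg_rpow {v : ℝ} (hv : 0 < v) :
    Tendsto (fun n : ℕ => (n : ℝ) ^ 2 *
      (2 * Real.exp (-((n : ℝ) ^ (1 / 36 : ℝ)) ^ 2 / (2 * v)))) atTop (𝓝 0) := by
  have hy : Tendsto (fun n : ℕ => (n : ℝ) ^ (1 / 18 : ℝ) / (2 * v)) atTop atTop :=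
    ((tendsto_rpow_atTop (by norm_num)).comp tendsto_natCast_atTop_atTop).atTop_div_const
      (by positivity)
  have h := ((Real.tendsto_pow_mul_exp_neg_atTop_nhds_zero 36).comp hy).const_mul
    (2 * (2 * v) ^ 36)
  rw [mul_zero] at h
  refine h.congr fun n => ?_
  have hn : (0 : ℝ) ≤ n := n.cast_nonneg
  have e1 : ((n : ℝ) ^ (1 / 18 : ℝ)) ^ 36 = (n : ℝ) ^ 2 := by
    rw [← Real.rpow_natCast, ← Real.rpow_mul hn, ← Real.rpow_natCast]; norm_num
  have e2 : ((n : ℝ) ^ (1 / 36 : ℝ)) ^ 2 = (n : ℝ) ^ (1 / 18 : ℝ) := by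
    rw [← Real.rpow_natCast, ← Real.rpow_mul hn]; norm_num
  simp only [Function.comp]
  rw [div_pow, e1, e2, neg_div]
  field_simp

theorem ceil_rpow_bounds {n : ℕ} (hn : 1 ≤ n) :
    (n : ℝ) ^ (1 / 3 : ℝ) ≤ ⌈(n : ℝ) ^ (1 / 3 : ℝ)⌉₊ ∧
      (⌈(n : ℝ) ^ (1 / 3 : ℝ)⌉₊ : ℝ) ≤ 2 * (n : ℝ) ^ (1 / 3 : ℝ) := by
  have h1 : (1 : ℝ) ≤ (n : ℝ) ^ (1 / 3 : ℝ) :=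
    Real.one_le_rpow (by exact_mod_cast hn) (by norm_num)
  exact ⟨Nat.le_ceil _, (Nat.ceil_lt_add_one (by linarith)).le.trans (by linarith)⟩

theorem tendsto_ceil_rpow_sq_div {δ : ℝ} (hδ : 0 < δ) :
    Tendsto (fun n : ℕ => 4 * (⌈(n : ℝ) ^ (1 / 3 : ℝ)⌉₊ : ℝ) ^ 2 / (n * δ)) atTop (𝓝 0) := by
  have hlim : Tendsto (fun n : ℕ => 16 / δ * (n : ℝ) ^ (-(1 / 3) : ℝ)) atTop (𝓝 0) := by
    have := ((tendsto_rpow_neg_atTop (y := 1 / 3) (by norm_num)).comp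
      tendsto_natCast_atTop_atTop).const_mul (16 / δ)
    rw [mul_zero] at this
    exact this
  refine squeeze_zero' (Eventually.of_forall fun n => by positivity) ?_ hlim
  filter_upwards [eventually_ge_atTop 1] with n hn
  have hn' : (0 : ℝ) < n := by exact_mod_cast hn
  have hc := (ceil_rpow_bounds hn).2
  have hs : (n : ℝ) ^ (-(1 / 3) : ℝ) * n = ((n : ℝ) ^ (1 / 3 : ℝ)) ^ 2 := by
    rw [← Real.rpow_add_one hn'.ne', ← Real.rpow_natCast, ← Real.rpow_mul hn'.le]; norm_num
  rw [div_le_iff₀ (by positivity)]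
  calc 4 * (⌈(n : ℝ) ^ (1 / 3 : ℝ)⌉₊ : ℝ) ^ 2 ≤ 4 * (2 * (n : ℝ) ^ (1 / 3 : ℝ)) ^ 2 := by gcongr
    _ = 16 / δ * ((n : ℝ) ^ (-(1 / 3) : ℝ) * n) * δ := by rw [hs]; field_simp; ring
    _ = _ := by ring

/-- With cells of length of order `n ^ (-1/3)` and noise level `n ^ (1/36)`, the uniform error of
the estimate is `O(n ^ (-11/36))`, which is of smaller order than the squared bandwidth. -/
theorem tendsto_rate_div_sq {c₀ δ L : ℝ} (hc₀ : 0 < c₀) (hδ : 0 < δ) (hL : 0 ≤ L) {h : ℕ → ℝ}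
    (hh : ∀ᶠ n : ℕ in atTop, c₀ / 2 * (n : ℝ) ^ (-(1 / 9) : ℝ) ≤ h n) :
    Tendsto (fun n : ℕ => (L * (2 / (⌈(n : ℝ) ^ (1 / 3 : ℝ)⌉₊ : ℝ)) + (n : ℝ) ^ (1 / 36 : ℝ) /
      √(n * δ / (2 * (⌈(n : ℝ) ^ (1 / 3 : ℝ)⌉₊ : ℝ)))) / h n ^ 2) atTop (𝓝 0) := by
  have hlim : Tendsto (fun n : ℕ => ((2 * L + 2 / √δ) * (4 / c₀ ^ 2)) *
      (n : ℝ) ^ (-(1 / 12) : ℝ)) atTop (𝓝 0) := by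
    have := ((tendsto_rpow_neg_atTop (y := 1 / 12) (by norm_num)).comp
      tendsto_natCast_atTop_atTop).const_mul ((2 * L + 2 / √δ) * (4 / c₀ ^ 2))
    rw [mul_zero] at this
    exact this
  refine squeeze_zero' (Eventually.of_forall fun n => by positivity) ?_ hlim
  filter_upwards [eventually_ge_atTop 1, hh] with n hn hhn
  have hn1 : (1 : ℝ) ≤ n := by exact_mod_cast hn
  have hn' : (0 : ℝ) < n := by linarith
  obtain ⟨hm1, hm2⟩ := ceil_rpow_bounds hn
  set m : ℝ := (⌈(n : ℝ) ^ (1 / 3 : ℝ)⌉₊ : ℝ)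
  have hs : 0 < (n : ℝ) ^ (1 / 3 : ℝ) := by positivity
  have hm : 0 < m := hs.trans_le hm1
  have hbias : L * (2 / m) ≤ 2 * L * (n : ℝ) ^ (-(11 / 36) : ℝ) := by
    have e1 : 1 / m ≤ (n : ℝ) ^ (-(11 / 36) : ℝ) := by
      calc 1 / m ≤ 1 / (n : ℝ) ^ (1 / 3 : ℝ) := by gcongr
        _ = (n : ℝ) ^ (-(1 / 3) : ℝ) := by rw [Real.rpow_neg hn'.le, one_div]
        _ ≤ _ := Real.rpow_le_rpow_of_exponent_le hn1 (by norm_num)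
    calc L * (2 / m) = 2 * L * (1 / m) := by ring
      _ ≤ _ := by gcongr
  have hnoise : (n : ℝ) ^ (1 / 36 : ℝ) / √(n * δ / (2 * m)) ≤
      2 / √δ * (n : ℝ) ^ (-(11 / 36) : ℝ) := by
    have e1 : √δ / 2 * (n : ℝ) ^ (1 / 3 : ℝ) ≤ √(n * δ / (2 * m)) := by
      refine Real.le_sqrt_of_sq_le ?_
      have e2 : (n : ℝ) = ((n : ℝ) ^ (1 / 3 : ℝ)) ^ 3 := by
        rw [← Real.rpow_natCast, ← Real.rpow_mul hn'.le]; norm_num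
      rw [le_div_iff₀ (by positivity), mul_pow, div_pow, Real.sq_sqrt hδ.le]
      calc δ / 2 ^ 2 * ((n : ℝ) ^ (1 / 3 : ℝ)) ^ 2 * (2 * m)
          ≤ δ / 2 ^ 2 * ((n : ℝ) ^ (1 / 3 : ℝ)) ^ 2 * (2 * (2 * (n : ℝ) ^ (1 / 3 : ℝ))) := by
            gcongr
        _ = ((n : ℝ) ^ (1 / 3 : ℝ)) ^ 3 * δ := by ring
        _ = n * δ := by rw [← e2]
    have e3 : (n : ℝ) ^ (1 / 36 : ℝ) =
        (n : ℝ) ^ (-(11 / 36) : ℝ) * (n : ℝ) ^ (1 / 3 : ℝ) := by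
      rw [← Real.rpow_add hn']; norm_num
    calc _ ≤ (n : ℝ) ^ (1 / 36 : ℝ) / (√δ / 2 * (n : ℝ) ^ (1 / 3 : ℝ)) := by gcongr
      _ = _ := by rw [e3]; field_simp
  have hsq : (c₀ / 2) ^ 2 * (n : ℝ) ^ (-(2 / 9) : ℝ) ≤ h n ^ 2 := by
    have e1 : (n : ℝ) ^ (-(2 / 9) : ℝ) = ((n : ℝ) ^ (-(1 / 9) : ℝ)) ^ 2 := by
      rw [← Real.rpow_natCast, ← Real.rpow_mul hn'.le]; norm_num
    rw [e1, ← mul_pow]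
    gcongr
  have e4 : (n : ℝ) ^ (-(11 / 36) : ℝ) =
      (n : ℝ) ^ (-(1 / 12) : ℝ) * (n : ℝ) ^ (-(2 / 9) : ℝ) := by
    rw [← Real.rpow_add hn']; norm_num
  calc _ ≤ ((2 * L + 2 / √δ) * (n : ℝ) ^ (-(11 / 36) : ℝ)) /
        ((c₀ / 2) ^ 2 * (n : ℝ) ^ (-(2 / 9) : ℝ)) := by
        gcongr
        linarith
    _ = _ := by rw [e4]; field_simp; ring

theorem bandwidth_bounds {c₀ : ℝ} (hc₀ : 0 < c₀) {h : ℕ → ℝ}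
    (hh : Asymptotics.IsEquivalent atTop h (fun n : ℕ => c₀ * (n : ℝ) ^ (-(1 / 9) : ℝ))) :
    Tendsto h atTop (𝓝 0) ∧ ∀ᶠ n : ℕ in atTop, c₀ / 2 * (n : ℝ) ^ (-(1 / 9) : ℝ) ≤ h n := by
  have hlim : Tendsto (fun n : ℕ => c₀ * (n : ℝ) ^ (-(1 / 9) : ℝ)) atTop (𝓝 0) := by
    have := ((tendsto_rpow_neg_atTop (y := 1 / 9) (by norm_num)).comp
      tendsto_natCast_atTop_atTop).const_mul c₀
    rw [mul_zero] at this
    exact this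
  refine ⟨hh.symm.tendsto_nhds hlim, ?_⟩
  filter_upwards [hh.bound (c := 1 / 2) (by norm_num)] with n hn
  rw [Real.norm_eq_abs, Real.norm_eq_abs, Pi.sub_apply,
    abs_of_nonneg (by positivity : 0 ≤ c₀ * (n : ℝ) ^ (-(1 / 9) : ℝ))] at hn
  linarith [(abs_le.1 hn).1]

/-! ### Consistency of the second derivative -/

theorem lemma1
    {Ω : Type*} [MeasurableSpace Ω] (μ : Measure Ω) [IsProbabilityMeasure μ]
    -- the kernel
    (K : ℝ → ℝ) (hK : IsSmoothingKernel K)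
    -- the regression function
    (f₀ : ℝ → ℝ) (hf₀_mono : MonotoneOn f₀ (Set.Icc 0 1))
    (hf₀_cont : ContinuousOn f₀ (Set.Icc 0 1))
    -- the design density
    (g : ℝ → ℝ) (hg_cont : ContinuousOn g (Set.Icc 0 1))
    (hg_pos : ∃ δ > 0, ∀ x ∈ Set.Icc (0 : ℝ) 1, δ ≤ g x)
    (hg_diff : DifferentiableOn ℝ g (Set.Ioo 0 1))
    (hg_deriv_cont : ContinuousOn (deriv g) (Set.Ioo 0 1))
    (hg_deriv_bdd : ∃ B, ∀ x ∈ Set.Ioo (0 : ℝ) 1, |deriv g x| ≤ B)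
    -- the design points: i.i.d. with density `g` on `[0, 1]`
    (X : ℕ → Ω → ℝ) (hX_meas : ∀ i, Measurable (X i))
    (hX_indep : iIndepFun X μ)
    (hX_law : ∀ i, μ.map (X i) =
      (volume.restrict (Set.Icc 0 1)).withDensity (fun x => ENNReal.ofReal (g x)))
    -- the errors: i.i.d., centred, sub-Gaussian, independent of the design
    (ε : ℕ → Ω → ℝ) (hε_meas : ∀ i, Measurable (ε i))
    (hε_indep : iIndepFun ε μ)
    (hε_ident : ∀ i, IdentDistrib (ε i) (ε 0) μ μ)
    (hε_subG : ∃ v : NNReal, HasSubgaussianMGF (ε 0) v μ)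
    (hε_mean : ∫ ω, ε 0 ω ∂μ = 0)
    (σ₀ : ℝ) (hσ₀ : 0 < σ₀) (hε_var : variance (ε 0) μ = σ₀ ^ 2)
    (hXε : IndepFun (fun ω i => X i ω) (fun ω i => ε i ω) μ)
    -- the responses
    (Y : ℕ → Ω → ℝ) (hY : ∀ i ω, Y i ω = f₀ (X i ω) + ε i ω)
    -- the monotone least squares estimator based on the first `n` pairs
    (fhat : ℕ → Ω → ℝ → ℝ)
    (hfhat : ∀ n ω, IsMonotoneLSE n (fun i => X i ω) (fun i => Y i ω) (fhat n ω))
    -- the point `t`: `f₀` is twice differentiable near `t` and `f₀''` is continuous at `t`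
    (t : ℝ) (ht : t ∈ Set.Ioo (0 : ℝ) 1)
    (hf₀_diff : ∀ᶠ x in 𝓝 t, DifferentiableAt ℝ f₀ x)
    (hf₀_diff2 : ∀ᶠ x in 𝓝 t, DifferentiableAt ℝ (deriv f₀) x)
    (hf₀_cont2 : ContinuousAt (iteratedDeriv 2 f₀) t)
    (hf₀_deriv : 0 < deriv f₀ t)
    (hf₀_deriv2 : iteratedDeriv 2 f₀ t ≠ 0)
    -- the pilot bandwidth
    (c₀ : ℝ) (hc₀ : 0 < c₀) (h₀ : ℕ → ℝ)
    (hh₀ : Asymptotics.IsEquivalent atTop h₀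
      (fun n : ℕ => c₀ * (n : ℝ) ^ (-(1 / 9) : ℝ))) :
    (∀ n ω, ContDiff ℝ 2 (slse K (h₀ n) (fhat n ω))) ∧
    TendstoInMeasure μ
      (fun (n : ℕ) (ω : Ω) => iteratedDeriv 2 (slse K (h₀ n) (fhat n ω)) t)
      atTop (fun _ => iteratedDeriv 2 f₀ t) := by
  have hmono : ∀ n ω, Monotone (fhat n ω) := fun n ω => (hfhat n ω).monotone
  refine ⟨fun n ω => contDiff_slse hK (h₀ n) (hmono n ω), ?_⟩
  obtain ⟨δ, hδ, hδg⟩ := hg_pos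
  obtain ⟨v₀, hv₀⟩ := hε_subG
  -- The variance proxy may be enlarged to be positive.
  have hsub : ∀ i, HasSubgaussianMGF (ε i) (v₀ + 1) μ := fun i =>
    (hv₀.congr_identDistrib (hε_ident i).symm).of_le (by simp)
  have hv : 0 < v₀ + 1 := by positivity
  have hd2 : DifferentiableAt ℝ (deriv f₀) t := hf₀_diff2.self_of_nhds
  obtain ⟨L, hL0, r₁, hr₁, hL⟩ := exists_lipschitz_near hf₀_diff hd2.continuousAt
  obtain ⟨M, hM0, hM⟩ := hK.exists_bound
  set r := min r₁ (min t (1 - t))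
  have hrpos : 0 < r := lt_min hr₁ (lt_min ht.1 (by linarith [ht.2]))
  have hr_le : r ≤ r₁ := min_le_left _ _
  have hr_t : r ≤ t := (min_le_right _ _).trans (min_le_left _ _)
  have hr_t' : r ≤ 1 - t := (min_le_right _ _).trans (min_le_right _ _)
  have hLr : ∀ x ∈ Set.Icc (t - r) (t + r), ∀ y ∈ Set.Icc (t - r) (t + r),
      |f₀ y - f₀ x| ≤ L * |y - x| := fun x hx y hy =>
    hL x ⟨by linarith [hx.1], by linarith [hx.2]⟩ y ⟨by linarith [hy.1], by linarith [hy.2]⟩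
  obtain ⟨hh0, hhlow⟩ := bandwidth_bounds hc₀ hh₀
  set m : ℕ → ℕ := fun n => ⌈(n : ℝ) ^ (1 / 3 : ℝ)⌉₊
  set lam : ℕ → ℝ := fun n => (n : ℝ) ^ (1 / 36 : ℝ) with hlam
  set N : ℕ → ℝ := fun n => n * δ / (2 * m n) with hNdef
  have hrate := tendsto_rate_div_sq hc₀ hδ hL0 hhlow
  have hm_lim : Tendsto (fun n => 2 / (m n : ℝ)) atTop (𝓝 0) := by
    refine Tendsto.div_atTop tendsto_const_nhds (tendsto_natCast_atTop_atTop.comp ?_)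
    exact tendsto_nat_ceil_atTop.comp
      ((tendsto_rpow_atTop (by norm_num)).comp tendsto_natCast_atTop_atTop)
  rw [tendstoInMeasure_iff_measureReal_norm]
  intro κ hκ
  set η := κ / (8 * M) with hη
  obtain ⟨r₂, hr₂, hT⟩ := exists_abs_sub_taylor_le hf₀_diff hd2 (show 0 < η by positivity)
  have hbad := (tendsto_sq_mul_exp_neg_rpow (v := (v₀ + 1 : NNReal)) hv).add
    (tendsto_ceil_rpow_sq_div hδ)
  rw [add_zero] at hbad
  refine squeeze_zero' (Eventually.of_forall fun n => measureReal_nonneg) ?_ hbad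
  have hη4 : 0 < κ / (4 * M) := by positivity
  filter_upwards [eventually_ge_atTop 1, hhlow, hh0.eventually_lt_const (half_pos hrpos),
    hh0.eventually_lt_const hr₂, hm_lim.eventually_lt_const (half_pos hrpos),
    hrate.eventually_lt_const hη4] with n hn hlow hhr hhr₂ hmr hrn
  have hn' : (0 : ℝ) < n := by exact_mod_cast hn
  have hh : 0 < h₀ n := lt_of_lt_of_le (by positivity) hlow
  have hmpos : 0 < m n := Nat.ceil_pos.2 (by positivity)
  have hmpos' : (0 : ℝ) < m n := by exact_mod_cast hmpos
  have hNpos : 0 < N n := by simp only [hNdef]; positivity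
  have hlam0 : 0 ≤ lam n := by simp only [hlam]; positivity
  -- Off an event of small probability the estimate is uniformly close to the Taylor polynomial.
  have hgood : ∀ ω, (∀ i, X i ω ∈ Set.Icc (0 : ℝ) 1) →
      NoiseBound n (fun i => X i ω) (fun i => ε i ω) (lam n) →
      CellBound n (m n) (N n) (fun i => X i ω) →
      ‖iteratedDeriv 2 (slse K (h₀ n) (fhat n ω)) t - iteratedDeriv 2 f₀ t‖ < κ := by
    intro ω hω hnoise hcell
    have hLSE : IsMonotoneLSE n (fun i => X i ω) (fun i => f₀ (X i ω) + ε i ω) (fhat n ω) := by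
      simpa only [hY] using hfhat n ω
    have hE : ∀ x ∈ Set.Icc (t - h₀ n) (t + h₀ n), |fhat n ω x -
        (f₀ t + deriv f₀ t * (x - t) + iteratedDeriv 2 f₀ t / 2 * (x - t) ^ 2)| ≤
        (L * (2 / m n) + lam n / √(N n)) + η * h₀ n ^ 2 := by
      intro x hx
      have hxt : |x - t| ≤ h₀ n := abs_le.2 ⟨by linarith [hx.1], by linarith [hx.2]⟩
      have e1 := hLSE.abs_sub_le hf₀_mono hω hlam0 hnoise hNpos hcell hmpos
        (by linarith) (by linarith) hLr (w := h₀ n) (by linarith) hx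
      have e2 := hT x (hxt.trans hhr₂.le)
      have e3 : η * (x - t) ^ 2 ≤ η * h₀ n ^ 2 :=
        mul_le_mul_of_nonneg_left (sq_le_sq' (abs_le.1 hxt).1 (abs_le.1 hxt).2) (by positivity)
      exact (abs_sub_le _ (f₀ x) _).trans (by linarith)
    have hfin := abs_iteratedDeriv_slse_sub_le hK hM hh (by linarith) (by linarith)
      (hmono n ω) hE
    rw [Real.norm_eq_abs]
    refine hfin.trans_lt ?_
    calc 2 * M * ((L * (2 / m n) + lam n / √(N n)) + η * h₀ n ^ 2) / h₀ n ^ 2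
        = 2 * M * ((L * (2 / m n) + lam n / √(N n)) / h₀ n ^ 2) + 2 * M * η := by field_simp
      _ < 2 * M * (κ / (4 * M)) + 2 * M * η := by gcongr
      _ ≤ κ := by rw [hη]; field_simp; norm_num
  have hsubset : {ω | κ ≤ ‖iteratedDeriv 2 (slse K (h₀ n) (fhat n ω)) t -
      iteratedDeriv 2 f₀ t‖} ≤ᵐ[μ]
      ({ω | ¬ NoiseBound n (fun i => X i ω) (fun i => ε i ω) (lam n)} ∪
        {ω | ¬ CellBound n (m n) (N n) (fun i => X i ω)} : Set Ω) := by
    filter_upwards [ae_forall_mem_Icc hX_meas hX_law] with ω hω hκω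
    by_contra hcon
    have hcon' := not_or.1 hcon
    exact absurd (hgood ω hω (not_not.1 hcon'.1) (not_not.1 hcon'.2)) (not_lt.2 hκω)
  calc _ ≤ μ.real ({ω | ¬ NoiseBound n (fun i => X i ω) (fun i => ε i ω) (lam n)} ∪
        {ω | ¬ CellBound n (m n) (N n) (fun i => X i ω)}) :=
        ENNReal.toReal_mono (measure_ne_top _ _) (measure_mono_ae hsubset)
    _ ≤ _ := measureReal_union_le _ _
    _ ≤ _ := add_le_add
      (measureReal_not_noiseBound_le hε_indep hX_meas hXε hv hsub hlam0 n)
      (measureReal_not_cellBound_le hX_meas hX_indep hδ hδg hX_law hn hmpos)
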